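/- For integers $\chi\ge 1$, $n\ge 0$ with $3\chi-n$ a non-negative even integer, take interior vertices $v_1,\dots,v_\chi$ with three half-edges each and boundary vertices $w_1,\dots,w_n$ with one half-edge each. Let $\mathcal F_{\chi,n}$ be the set of partitions of the $3\chi+n$ half-edges into pairs such that every pair contains at least one half-edge of an interior vertex; each such partition is regarded as the multigraph (loops and multiple edges allowed) obtained by gluing the two half-edges of every pair to an edge. For a connected graph $G\in\mathcal F_{\chi,n}$ with vertex set $V$ and edge set $E$, its topological genus is $1-(|V|-|E|)=\frac{\chi-n}{2}+1$. Its Laplacian is the operator on $\mathbb R^{V}$ given by $\Delta_G f(v)=\frac1{\deg v}\sum_{w\sim v}(f(w)-f(v))$, where the sum is over the edges at $v$ with multiplicity and a loop counts twice in $\deg v$; $0=\lambda_0(G)<\lambda_1(G)\le\lambda_2(G)\le\cdots$ denote the eigenvalues of $-\Delta_G$ counted with multiplicity. **Theorem 1.3.** For every real $\theta>0$ there exist a function $n:\mathbb Z^+\to\mathbb Z^+$ and a sequence of connected graphs $\{G_g\}_{g\ge 1}$ such that 1. $G_g\in\mathcal F_{2g-2+n(g),\,n(g)}$ for every $g\ge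 1$, i.e. $G_g$ has $2g-2+n(g)$ vertices of degree $3$, $n(g)$ vertices of degree $1$, and topological genus $g$; 2. $\displaystyle\lim_{g\to\infty}\frac{n(g)}{g}=\theta$; 3. $\displaystyle\liminf_{g\to\infty}\lambda_1(G_g)\ge\frac{1}{648(\theta+4)^2}$. -/

import Mathlib

namespace ConfigModel

/-- Half-edges: three at each of the `χ` interior vertices (`Sum.inl (i, a)` is the `a`-th one at
`v_i`) and one at each of the `n` boundary vertices (`Sum.inr j` is the one at `w_j`). -/
abbrev HalfEdge (χ n : ℕ) : Type := (Fin χ × Fin 3) ⊕ Fin n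

/-- Vertices: interior vertices `v_i = Sum.inl i` and boundary vertices `w_j = Sum.inr j`. -/
abbrev Vertex (χ n : ℕ) : Type := Fin χ ⊕ Fin n

/-- The vertex from which a half-edge emanates. -/
def origin {χ n : ℕ} : HalfEdge χ n → Vertex χ n
  | Sum.inl (i, _) => Sum.inl i
  | Sum.inr j => Sum.inr j

end ConfigModel

/-- The set `𝓕_{χ,n}` of good partitions: partitions of the set of half-edges into pairs
`{h, mate h}` (encoded as fixed-point free involutions) such that each pair contains at least one
half-edge emanating from an interior vertex. Every good partition is regarded as the multigraph
(loops and multiple edges allowed) obtained by gluing `h` to `mate h` for all `h`. -/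
structure ConfigGraph (χ n : ℕ) where
  mate : ConfigModel.HalfEdge χ n → ConfigModel.HalfEdge χ n
  mate_mate : ∀ h, mate (mate h) = h
  mate_ne : ∀ h, mate h ≠ h
  good : ∀ h, h.isLeft = true ∨ (mate h).isLeft = true

namespace ConfigGraph

open ConfigModel

variable {χ n : ℕ} (G : ConfigGraph χ n)

/-- The edges of the multigraph, i.e. the pairs of half-edges of the partition. -/
def edges : Finset (Sym2 (HalfEdge χ n)) :=
  Finset.univ.image fun h => s(h, G.mate h)

/-- The degree of `v`: the number of half-edges emanating from `v`. As every half-edge belongs to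
exactly one edge, this is the number of edges at `v`, where every loop counts twice. -/
def degree (_G : ConfigGraph χ n) (v : Vertex χ n) : ℕ :=
  (Finset.univ.filter fun h : HalfEdge χ n => origin h = v).card

/-- The Euler characteristic `|V| - |E|`. -/
def eulerChar : ℤ := (Fintype.card (Vertex χ n) : ℤ) - (G.edges.card : ℤ)

/-- The topological genus `1 - χ(G)`. -/
def genus : ℤ := 1 - G.eulerChar

/-- The simple graph that remains when loops are deleted and parallel edges are merged. -/
def toSimpleGraph : SimpleGraph (Vertex χ n) :=
  SimpleGraph.fromRel fun v w => ∃ h, origin h = v ∧ origin (G.mate h) = w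

/-- The multigraph is connected (loops and multiplicities are irrelevant for this). -/
def Connected : Prop := G.toSimpleGraph.Connected

/-- The normalized Laplacian `Δ f (v) = (1 / deg v) ∑_{w ∼ v} (f w - f v)`. The sum is over the
half-edges at `v`, so it runs over the edges at `v` with their multiplicities; loops contribute
zero. -/
noncomputable def laplacian : (Vertex χ n → ℝ) →ₗ[ℝ] (Vertex χ n → ℝ) where
  toFun f v := (1 / (G.degree v : ℝ)) *
    ∑ h : HalfEdge χ n with origin h = v, (f (origin (G.mate h)) - f v)
  map_add' f f' := by
    funext v
    simp only [Pi.add_apply, ← mul_add, ← Finset.sum_add_distrib]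
    congr 1
    exact Finset.sum_congr rfl fun _ _ => by ring
  map_smul' c f := by
    funext v
    simp only [Pi.smul_apply, smul_eq_mul, RingHom.id_apply, ← mul_sub, ← Finset.mul_sum]
    ring

/-- The eigenvalues of `-Δ`, with multiplicity, in increasing order. -/
noncomputable def eigenvalueList : List ℝ :=
  (LinearMap.charpoly (-G.laplacian)).roots.sort (· ≤ ·)

/-- The first Laplacian eigenvalue `λ₁(G)`: the entry with index `1` of the increasing list
`λ₀ ≤ λ₁ ≤ …` of eigenvalues of `-Δ` (the value `0` is a convention for graphs with fewer than
two vertices). -/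
noncomputable def lambda1 : ℝ := G.eigenvalueList.getD 1 0

end ConfigGraph

/-! The graphs are explicit: an expander is hidden inside a cubic graph. The χ interior vertices
form one cycle, which uses two half-edges at each of them and makes the graph connected. The cycle
is cut into m² arcs of length at least 8, one for each point of the torus (ℤ/m)². The third
half-edges of the first eight vertices of each arc are joined as in the 8-regular Gabber–Galil graph
on the torus; n of the remaining third half-edges carry the boundary vertices, and the rest are
paired arbitrarily.

The gap survives this blow-up. By `Margulis.gap`, the energy of the expander edges controls the
values at the arc centres, up to the oscillation inside the arcs. Cauchy–Schwarz along an arc bounds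
that oscillation, and the passage from the centre to the whole arc, by the energy of the cycle. Each
boundary vertex is compared with its neighbour. This is `poincare_of_centres`, with a constant
quadratic in the maximal arc length K. `le_lambda1` turns such a Poincaré inequality into a bound
for λ₁.

With m² ~ g/4 and χ ~ (θ + 2)g, any K > 4θ + 8 is eventually admissible, which gives a bound of
order (θ + 4)⁻².

The gap of the torus graph is proved by Fourier analysis. Shears act on frequencies by transposed
shears, and translation by 0 or 1 produces the factors 1 + e(-k/m). Far from frequency 0 these
factors are small; near 0 most neighbours of a frequency are larger than it, so a weighted AM–GM
inequality wins. Mean zero removes frequency 0 itself. -/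

open Finset

/-! ### Gabber–Galil graph: sizes of frequencies and edge weights -/

namespace Margulis

variable {m : ℕ} [NeZero m]

/-- The affine permutations of the torus that generate the Gabber–Galil expander. -/
def shear (m : ℕ) : Fin 2 × ZMod m → Equiv.Perm (ZMod m × ZMod m)
  | (0, c) =>
    { toFun := fun z => (z.1 + 2 * z.2 + c, z.2)
      invFun := fun z => (z.1 - 2 * z.2 - c, z.2)
      left_inv := fun z => by ext <;> simp; ring
      right_inv := fun z => by ext <;> simp; ring }
  | (1, c) =>
    { toFun := fun z => (z.1, z.2 + 2 * z.1 + c)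
      invFun := fun z => (z.1, z.2 - 2 * z.1 - c)
      left_inv := fun z => by ext <;> simp; ring
      right_inv := fun z => by ext <;> simp; ring }

/-- The size of a point of the torus, measured by absolutely smallest residues. -/
def size (z : ZMod m × ZMod m) : ℤ := |z.1.valMinAbs| + |z.2.valMinAbs|

/-- Weights for the arithmetic-geometric mean inequality along an edge. -/
noncomputable def weight (z w : ZMod m × ZMod m) : ℝ :=
  if size w < size z then 5 / 4 else if size z < size w then 4 / 5 else 1

omit [NeZero m] in
lemma weight_le (z w : ZMod m × ZMod m) : weight z w ≤ 5 / 4 := by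
  unfold weight; split_ifs <;> norm_num

omit [NeZero m] in
lemma weight_nonneg (z w : ZMod m × ZMod m) : 0 ≤ weight z w := by
  unfold weight; split_ifs <;> norm_num

omit [NeZero m] in
lemma weight_of_lt {z w : ZMod m × ZMod m} (h : size z < size w) : weight z w = 4 / 5 := by
  unfold weight; rw [if_neg h.not_gt, if_pos h]

omit [NeZero m] in
lemma weight_of_eq {z w : ZMod m × ZMod m} (h : size z = size w) : weight z w = 1 := by
  unfold weight; simp [h]

omit [NeZero m] in
-- The two weights of an edge are reciprocal, so this is 2xy ≤ t x² + t⁻¹ y². The endpoint of larger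
-- size gets the larger weight; a point with mostly larger neighbours is therefore charged little.
lemma two_mul_le_weight (z w : ZMod m × ZMod m) (x y : ℝ) :
    2 * (x * y) ≤ weight z w * x ^ 2 + weight w z * y ^ 2 := by
  rcases lt_trichotomy (size z) (size w) with h | h | h
  · have : weight w z = 5 / 4 := by unfold weight; rw [if_pos h]
    rw [weight_of_lt h, this]; nlinarith [sq_nonneg (4 * x - 5 * y)]
  · rw [weight_of_eq h, weight_of_eq h.symm]; nlinarith [sq_nonneg (x - y)]
  · have : weight z w = 5 / 4 := by unfold weight; rw [if_pos h]
    rw [weight_of_lt h, this]; nlinarith [sq_nonneg (5 * x - 4 * y)]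

omit [NeZero m] in
lemma exists_valMinAbs_eq (x : ZMod m) (y : ℤ) (h : x = (y : ZMod m)) :
    ∃ k : ℤ, x.valMinAbs = y + k * m := by
  have h1 : ((x.valMinAbs : ℤ) : ZMod m) = (y : ZMod m) := by rw [ZMod.coe_valMinAbs, h]
  rw [ZMod.intCast_eq_intCast_iff_dvd_sub] at h1
  obtain ⟨k, hk⟩ := h1
  exact ⟨-k, by linarith⟩

/-- Comparison of the absolutely smallest residues of `b ± 2 a` with that of `b`. -/
lemma abs_residue_cases {M A B P Q : ℤ} (hAB : 2 * (|A| + |B|) < M)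
    (hP : ∃ k, P = B - 2 * A + k * M) (hQ : ∃ k, Q = B + 2 * A + k * M)
    (hP1 : -M < P * 2) (hP2 : P * 2 ≤ M) (hQ1 : -M < Q * 2) (hQ2 : Q * 2 ≤ M) :
    (|B| < |A| → |B| < |P| ∧ |B| < |Q|) ∧
    (|A| = |B| → A ≠ 0 → |B| < |P| ∧ |B| = |Q| ∨ |B| = |P| ∧ |B| < |Q|) ∧
    (|A| < |B| → |B| < |P| ∨ |B| < |Q| ∨ |B| = |P| ∧ |B| = |Q|) := by
  obtain ⟨k, hk⟩ := hP
  obtain ⟨l, hl⟩ := hQ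
  have hM : 0 < M := by have := abs_nonneg A; have := abs_nonneg B; omega
  have hA := abs_le.1 (le_refl |A|)
  have hB := abs_le.1 (le_refl |B|)
  -- Here |B ± 2A| < M, so reduction to the smallest residue wraps around at most once.
  have hk' : -2 < k ∧ k < 2 := by constructor <;> nlinarith
  have hl' : -2 < l ∧ l < 2 := by constructor <;> nlinarith
  have hk2 : k = -1 ∨ k = 0 ∨ k = 1 := by omega
  have hl2 : l = -1 ∨ l = 0 ∨ l = 1 := by omega
  rcases hk2 with rfl | rfl | rfl <;> rcases hl2 with rfl | rfl | rfl <;>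
    (simp only [abs_eq_max_neg] at *; omega)

/-- Near the origin either at least three of the four neighbours are larger, or two are larger and
two have equal size. The totals are at most 3 · 4/5 + 5/4 = 73/20 and 2 · 4/5 + 2 = 18/5. -/
lemma sum_weight_le (z : ZMod m × ZMod m) (hz : z ≠ 0) (h : 2 * size z < m) :
    weight z (z.1, z.2 - 2 * z.1) + weight z (z.1, z.2 + 2 * z.1) +
      (weight z (z.1 - 2 * z.2, z.2) + weight z (z.1 + 2 * z.2, z.2)) ≤ 73 / 20 := by
  obtain ⟨a, b⟩ := z
  have key : ∀ a b : ZMod m, (∃ k : ℤ, (b - 2 * a).valMinAbs =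
      b.valMinAbs - 2 * a.valMinAbs + k * m) ∧ (∃ k : ℤ, (b + 2 * a).valMinAbs =
      b.valMinAbs + 2 * a.valMinAbs + k * m) := by
    intro a b
    constructor <;> apply exists_valMinAbs_eq <;> push_cast <;> simp
  have h1 := abs_residue_cases (A := a.valMinAbs) (B := b.valMinAbs) (M := m) (by simpa [size] using h)
    (key a b).1 (key a b).2 (ZMod.valMinAbs_mem_Ioc _).1 (ZMod.valMinAbs_mem_Ioc _).2
    (ZMod.valMinAbs_mem_Ioc _).1 (ZMod.valMinAbs_mem_Ioc _).2
  have h2 := abs_residue_cases (A := b.valMinAbs) (B := a.valMinAbs) (M := m)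
    (by simpa [size, add_comm] using h)
    (key b a).1 (key b a).2 (ZMod.valMinAbs_mem_Ioc _).1 (ZMod.valMinAbs_mem_Ioc _).2
    (ZMod.valMinAbs_mem_Ioc _).1 (ZMod.valMinAbs_mem_Ioc _).2
  obtain ⟨p1, p2, p3⟩ := h1
  obtain ⟨q1, q2, q3⟩ := h2
  have lt1 : ∀ {b' : ZMod m}, |b.valMinAbs| < |b'.valMinAbs| → weight (a, b) (a, b') = 4 / 5 :=
    fun h => weight_of_lt (by simpa [size] using h)
  have eq1 : ∀ {b' : ZMod m}, |b.valMinAbs| = |b'.valMinAbs| → weight (a, b) (a, b') = 1 :=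
    fun h => weight_of_eq (by simpa [size] using h)
  have lt2 : ∀ {a' : ZMod m}, |a.valMinAbs| < |a'.valMinAbs| → weight (a, b) (a', b) = 4 / 5 :=
    fun h => weight_of_lt (by simpa [size] using h)
  have eq2 : ∀ {a' : ZMod m}, |a.valMinAbs| = |a'.valMinAbs| → weight (a, b) (a', b) = 1 :=
    fun h => weight_of_eq (by simpa [size] using h)
  have w1 := weight_le (a, b) (a, b - 2 * a)
  have w2 := weight_le (a, b) (a, b + 2 * a)
  have w3 := weight_le (a, b) (a - 2 * b, b)
  have w4 := weight_le (a, b) (a + 2 * b, b)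
  simp only
  rcases lt_trichotomy |a.valMinAbs| |b.valMinAbs| with h | h | h
  · obtain ⟨r1, r2⟩ := q1 h
    rw [lt2 r1, lt2 r2]
    rcases p3 h with r | r | ⟨r, r'⟩
    · rw [lt1 r]; linarith
    · rw [lt1 r]; linarith
    · rw [eq1 r, eq1 r']; norm_num
  · have ha : a.valMinAbs ≠ 0 := by
      intro ha
      have hb : b.valMinAbs = 0 := by rw [ha] at h; simpa using h.symm
      exact hz (by rw [(ZMod.valMinAbs_eq_zero a).1 ha, (ZMod.valMinAbs_eq_zero b).1 hb]; rfl)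
    have hb : b.valMinAbs ≠ 0 := by
      intro hb; rw [hb] at h; exact ha (by simpa using h)
    rcases p2 h ha with ⟨r, r'⟩ | ⟨r, r'⟩ <;> rcases q2 h.symm hb with ⟨t, t'⟩ | ⟨t, t'⟩
    · rw [lt1 r, eq1 r', lt2 t, eq2 t']; norm_num
    · rw [lt1 r, eq1 r', eq2 t, lt2 t']; norm_num
    · rw [eq1 r, lt1 r', lt2 t, eq2 t']; norm_num
    · rw [eq1 r, lt1 r', eq2 t, lt2 t']; norm_num
  · obtain ⟨r1, r2⟩ := p1 h
    rw [lt1 r1, lt1 r2]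
    rcases q3 h with r | r | ⟨r, r'⟩
    · rw [lt2 r]; linarith
    · rw [lt2 r]; linarith
    · rw [eq2 r, eq2 r']; norm_num

/-! ### Damping factors of the frequencies -/

/-- Half the modulus of `1 + e(-a / m)`. -/
noncomputable def halfNorm (a : ZMod m) : ℝ := ‖1 + ZMod.stdAddChar (-a)‖ / 2

lemma halfNorm_nonneg (a : ZMod m) : 0 ≤ halfNorm a := by unfold halfNorm; positivity

lemma halfNorm_eq (a : ZMod m) :
    halfNorm a = Real.cos (Real.pi * |(a.valMinAbs : ℝ)| / m) := by
  have hm : (0 : ℝ) < m := by exact_mod_cast Nat.pos_of_ne_zero (NeZero.ne m)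
  set φ : ℝ := Real.pi * (a.valMinAbs : ℝ) / m with hφ
  have h1 : (ZMod.stdAddChar (-a) : ℂ) = Complex.exp (((-(2 * φ) : ℝ) : ℂ) * Complex.I) := by
    have : (-a : ZMod m) = ((-a.valMinAbs : ℤ) : ZMod m) := by simp
    rw [this, ZMod.stdAddChar_coe]
    congr 1
    rw [hφ]; push_cast; ring
  have hab : 0 ≤ Real.cos (Real.pi * |(a.valMinAbs : ℝ)| / m) := by
    have h := ZMod.valMinAbs_mem_Ioc a
    have h' : |(a.valMinAbs : ℝ)| * 2 ≤ m := by
      have : |a.valMinAbs| * 2 ≤ (m : ℤ) := by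
        have h1 := h.1; have h2 := h.2
        rw [abs_eq_max_neg]; omega
      exact_mod_cast this
    apply Real.cos_nonneg_of_mem_Icc
    constructor
    · have : 0 ≤ Real.pi * |(a.valMinAbs : ℝ)| / m := by positivity
      linarith [Real.pi_pos]
    · rw [div_le_iff₀ hm]; nlinarith [Real.pi_pos]
  have hcos : Real.cos (Real.pi * |(a.valMinAbs : ℝ)| / m) = |Real.cos φ| := by
    rw [← abs_of_nonneg hab]
    congr 1
    rcases abs_choice (a.valMinAbs : ℝ) with h | h
    · rw [h]
    · rw [h, hφ, ← Real.cos_neg]; congr 1; ring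
  have hsq : ‖1 + ZMod.stdAddChar (-a)‖ ^ 2 = (2 * |Real.cos φ|) ^ 2 := by
    rw [h1, ← Complex.normSq_eq_norm_sq, Complex.exp_mul_I, ← Complex.ofReal_cos,
      ← Complex.ofReal_sin, Complex.normSq_apply]
    simp only [Complex.add_re, Complex.add_im, Complex.one_re, Complex.one_im, Complex.ofReal_re,
      Complex.ofReal_im, Complex.mul_re, Complex.mul_im, Complex.I_re, Complex.I_im]
    rw [mul_pow, sq_abs, Real.cos_neg, Real.sin_neg]
    nlinarith [Real.sin_sq_add_cos_sq (2 * φ), Real.cos_two_mul φ]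
  rw [hcos]
  have := (sq_eq_sq₀ (norm_nonneg _) (by positivity)).1 hsq
  unfold halfNorm; linarith

lemma halfNorm_le_one (a : ZMod m) : halfNorm a ≤ 1 := by
  rw [halfNorm_eq]; exact Real.cos_le_one _

/-- The factors are cosines of angles x, y in [0, π/2] with x + y ≥ π/2, so their sum is at most cos
x + sin x ≤ √2. The value 1.46 is chosen since 1.46 · 2 · 5/4 = 73/20, the bound available near the
origin. -/
lemma halfNorm_add_le (a b : ZMod m) (h : (m : ℤ) ≤ 2 * size (a, b)) :
    halfNorm a + halfNorm b ≤ 146 / 100 := by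
  have hm : (0 : ℝ) < m := by exact_mod_cast Nat.pos_of_ne_zero (NeZero.ne m)
  rw [halfNorm_eq, halfNorm_eq]
  have hle : ∀ a : ZMod m, |(a.valMinAbs : ℝ)| * 2 ≤ m := by
    intro a
    have : |a.valMinAbs| * 2 ≤ (m : ℤ) := by
      have h1 := (ZMod.valMinAbs_mem_Ioc a).1; have h2 := (ZMod.valMinAbs_mem_Ioc a).2
      rw [abs_eq_max_neg]; omega
    exact_mod_cast this
  have hab : (m : ℝ) ≤ 2 * (|(a.valMinAbs : ℝ)| + |(b.valMinAbs : ℝ)|) := by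
    unfold size at h; exact_mod_cast h
  set x := Real.pi * |(a.valMinAbs : ℝ)| / m with hx
  set y := Real.pi * |(b.valMinAbs : ℝ)| / m with hy
  have hx0 : 0 ≤ x := by positivity
  have hx1 : x ≤ Real.pi / 2 := by
    rw [hx, div_le_iff₀ hm]; nlinarith [Real.pi_pos, hle a]
  have hy1 : y ≤ Real.pi / 2 := by
    rw [hy, div_le_iff₀ hm]; nlinarith [Real.pi_pos, hle b]
  have hxy : Real.pi / 2 - x ≤ y := by
    have : Real.pi / 2 ≤ x + y := by
      rw [hx, hy, ← add_div, le_div_iff₀ hm]; nlinarith [Real.pi_pos]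
    linarith
  have h1 : Real.cos y ≤ Real.sin x := by
    rw [← Real.cos_pi_div_two_sub]
    exact Real.cos_le_cos_of_nonneg_of_le_pi (by linarith) (by linarith [Real.pi_pos]) hxy
  nlinarith [Real.sin_sq_add_cos_sq x, sq_nonneg (Real.sin x - Real.cos x)]

lemma coefficient_le (z : ZMod m × ZMod m) (hz : z ≠ 0) :
    halfNorm z.1 * (weight z (z.1, z.2 - 2 * z.1) + weight z (z.1, z.2 + 2 * z.1)) +
      halfNorm z.2 * (weight z (z.1 - 2 * z.2, z.2) + weight z (z.1 + 2 * z.2, z.2))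
      ≤ 73 / 20 := by
  have w1 := weight_le z (z.1, z.2 - 2 * z.1)
  have w2 := weight_le z (z.1, z.2 + 2 * z.1)
  have w3 := weight_le z (z.1 - 2 * z.2, z.2)
  have w4 := weight_le z (z.1 + 2 * z.2, z.2)
  have v1 := weight_nonneg z (z.1, z.2 - 2 * z.1)
  have v2 := weight_nonneg z (z.1, z.2 + 2 * z.1)
  have v3 := weight_nonneg z (z.1 - 2 * z.2, z.2)
  have v4 := weight_nonneg z (z.1 + 2 * z.2, z.2)
  rcases lt_or_ge (2 * size z) (m : ℤ) with h | h
  · have := sum_weight_le z hz h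
    nlinarith [halfNorm_le_one z.1, halfNorm_le_one z.2]
  · have := halfNorm_add_le z.1 z.2 h
    nlinarith [halfNorm_nonneg z.1, halfNorm_nonneg z.2]

/-- After AM–GM, the term at the sheared point is moved back to z by reindexing. Each shear fixes
the coordinate on which its damping factor depends, so all weights collect at z and `coefficient_le`
applies; the hypothesis at 0 covers the one point where that fails. -/
lemma sum_mul_le (Φ : ZMod m × ZMod m → ℝ) (h0 : Φ 0 = 0) :
    ∑ z, 2 * (halfNorm z.1 * (Φ z * Φ (z.1, z.2 - 2 * z.1)) +
      halfNorm z.2 * (Φ z * Φ (z.1 - 2 * z.2, z.2))) ≤ 73 / 20 * ∑ z, Φ z ^ 2 := by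
  have e1 : ∑ z : ZMod m × ZMod m, halfNorm z.1 * (weight (z.1, z.2 - 2 * z.1) z *
        Φ (z.1, z.2 - 2 * z.1) ^ 2) =
      ∑ z : ZMod m × ZMod m, halfNorm z.1 * (weight z (z.1, z.2 + 2 * z.1) * Φ z ^ 2) := by
    refine Fintype.sum_equiv (shear m (1, 0)).symm _ _ fun z => ?_
    simp [shear]
  have e2 : ∑ z : ZMod m × ZMod m, halfNorm z.2 * (weight (z.1 - 2 * z.2, z.2) z *
        Φ (z.1 - 2 * z.2, z.2) ^ 2) =
      ∑ z : ZMod m × ZMod m, halfNorm z.2 * (weight z (z.1 + 2 * z.2, z.2) * Φ z ^ 2) := by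
    refine Fintype.sum_equiv (shear m (0, 0)).symm _ _ fun z => ?_
    simp [shear]
  calc _ ≤ ∑ z : ZMod m × ZMod m, (halfNorm z.1 * (weight z (z.1, z.2 - 2 * z.1) * Φ z ^ 2) +
          halfNorm z.1 * (weight (z.1, z.2 - 2 * z.1) z * Φ (z.1, z.2 - 2 * z.1) ^ 2) +
          (halfNorm z.2 * (weight z (z.1 - 2 * z.2, z.2) * Φ z ^ 2) +
          halfNorm z.2 * (weight (z.1 - 2 * z.2, z.2) z * Φ (z.1 - 2 * z.2, z.2) ^ 2))) := by
        refine sum_le_sum fun z _ => ?_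
        have a1 := mul_le_mul_of_nonneg_left
          (two_mul_le_weight z (z.1, z.2 - 2 * z.1) (Φ z) (Φ (z.1, z.2 - 2 * z.1)))
          (halfNorm_nonneg z.1)
        have a2 := mul_le_mul_of_nonneg_left
          (two_mul_le_weight z (z.1 - 2 * z.2, z.2) (Φ z) (Φ (z.1 - 2 * z.2, z.2)))
          (halfNorm_nonneg z.2)
        linarith
    _ = ∑ z : ZMod m × ZMod m, (halfNorm z.1 * (weight z (z.1, z.2 - 2 * z.1) +
          weight z (z.1, z.2 + 2 * z.1)) + halfNorm z.2 * (weight z (z.1 - 2 * z.2, z.2) +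
          weight z (z.1 + 2 * z.2, z.2))) * Φ z ^ 2 := by
        simp only [sum_add_distrib, e1, e2]
        simp only [← sum_add_distrib]
        exact sum_congr rfl fun z _ => by ring
    _ ≤ ∑ z, 73 / 20 * Φ z ^ 2 := by
        refine sum_le_sum fun z _ => ?_
        by_cases hz : z = 0
        · simp [hz, h0]
        · exact mul_le_mul_of_nonneg_right (coefficient_le z hz) (sq_nonneg _)
    _ = _ := by rw [mul_sum]

/-! ### Fourier transform on the torus and the spectral gap -/

/-- The Fourier transform of a real function on the torus. -/
noncomputable def fourier (f : ZMod m × ZMod m → ℝ) (k : ZMod m × ZMod m) : ℂ :=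
  ∑ x, (f x : ℂ) * ZMod.stdAddChar (k.1 * x.1 + k.2 * x.2)

lemma conj_stdAddChar (x : ZMod m) :
    (starRingEnd ℂ) (ZMod.stdAddChar x) = ZMod.stdAddChar (-x) := by
  rw [ZMod.stdAddChar_apply, ZMod.stdAddChar_apply, AddChar.map_neg_eq_inv, Circle.coe_inv_eq_conj]

lemma sum_stdAddChar (w : ZMod m × ZMod m) :
    ∑ k : ZMod m × ZMod m, (ZMod.stdAddChar (k.1 * w.1 + k.2 * w.2) : ℂ) =
      if w = 0 then (m : ℂ) ^ 2 else 0 := by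
  have h := fun b : ZMod m => AddChar.sum_mulShift b (ZMod.isPrimitive_stdAddChar m)
  simp only [ZMod.card] at h
  simp only [AddChar.map_add_eq_mul, Fintype.sum_prod_type]
  rw [← Fintype.sum_mul_sum, h, h]
  rcases w with ⟨a, b⟩
  by_cases ha : a = 0 <;> by_cases hb : b = 0 <;> simp [ha, hb, sq]

lemma parseval (f g : ZMod m × ZMod m → ℝ) :
    ∑ k, fourier f k * (starRingEnd ℂ) (fourier g k) = ((m ^ 2 * ∑ x, f x * g x : ℝ) : ℂ) := by
  have h1 : ∀ k, fourier f k * (starRingEnd ℂ) (fourier g k) =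
      ∑ x, ∑ y, ((f x : ℂ) * g y) *
        ZMod.stdAddChar (k.1 * (x - y).1 + k.2 * (x - y).2) := by
    intro k
    simp only [fourier, map_sum, map_mul, Complex.conj_ofReal, conj_stdAddChar,
      Fintype.sum_mul_sum]
    refine sum_congr rfl fun x _ => sum_congr rfl fun y _ => ?_
    have : k.1 * (x - y).1 + k.2 * (x - y).2 =
        (k.1 * x.1 + k.2 * x.2) + -(k.1 * y.1 + k.2 * y.2) := by
      simp only [Prod.fst_sub, Prod.snd_sub]; ring
    rw [this, AddChar.map_add_eq_mul _ (k.1 * x.1 + k.2 * x.2)]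
    ring
  simp only [h1]
  rw [sum_comm]
  have h2 : ∀ x : ZMod m × ZMod m, (∑ k : ZMod m × ZMod m, ∑ y, ((f x : ℂ) * g y) *
        ZMod.stdAddChar (k.1 * (x - y).1 + k.2 * (x - y).2)) = (m : ℂ) ^ 2 * (f x * g x) := by
    intro x
    rw [sum_comm]
    simp only [← mul_sum, sum_stdAddChar, sub_eq_zero, mul_ite, mul_zero, sum_ite_eq, mem_univ,
      if_true]
    ring
  simp only [h2]
  push_cast
  rw [mul_sum]

lemma fourier_shear_zero (f : ZMod m × ZMod m → ℝ) (c : ZMod m) (k : ZMod m × ZMod m) :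
    fourier (fun x => f (shear m (0, c) x)) k =
      ZMod.stdAddChar (-(k.1 * c)) * fourier f (k.1, k.2 - 2 * k.1) := by
  unfold fourier
  rw [mul_sum]
  refine Fintype.sum_equiv (shear m (0, c)) _ _ fun x => ?_
  rw [mul_left_comm, ← AddChar.map_add_eq_mul]
  congr 2
  simp only [shear, Equiv.coe_fn_mk]
  ring

lemma fourier_shear_one (f : ZMod m × ZMod m → ℝ) (c : ZMod m) (k : ZMod m × ZMod m) :
    fourier (fun x => f (shear m (1, c) x)) k =
      ZMod.stdAddChar (-(k.2 * c)) * fourier f (k.1 - 2 * k.2, k.2) := by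
  unfold fourier
  rw [mul_sum]
  refine Fintype.sum_equiv (shear m (1, c)) _ _ fun x => ?_
  rw [mul_left_comm, ← AddChar.map_add_eq_mul]
  congr 2
  simp only [shear, Equiv.coe_fn_mk]
  ring

lemma fourier_add (f g : ZMod m × ZMod m → ℝ) (k : ZMod m × ZMod m) :
    fourier (fun x => f x + g x) k = fourier f k + fourier g k := by
  simp [fourier, add_mul, sum_add_distrib]

/-- By Parseval the correlation becomes a sum over frequencies. The translates c = 0 and c = 1 of
one shear combine into the factor 1 + e(-k/m), of modulus twice `halfNorm`, and taking absolute
values reduces to `sum_mul_le`. -/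
lemma sum_mul_shear_le (f : ZMod m × ZMod m → ℝ) (hf : ∑ z, f z = 0) :
    ∑ z, f z * ((f (shear m (0, 0) z) + f (shear m (0, 1) z)) +
      (f (shear m (1, 0) z) + f (shear m (1, 1) z))) ≤ 73 / 20 * ∑ z, f z ^ 2 := by
  have hm : (0 : ℝ) < (m : ℝ) ^ 2 := by
    have : (0 : ℝ) < m := by exact_mod_cast Nat.pos_of_ne_zero (NeZero.ne m)
    positivity
  have p1 := parseval f (fun z => (f (shear m (0, 0) z) + f (shear m (0, 1) z)) +
      (f (shear m (1, 0) z) + f (shear m (1, 1) z)))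
  have p2 := parseval f f
  simp only [fourier_add, fourier_shear_zero, fourier_shear_one, mul_zero, mul_one, neg_zero,
    AddChar.map_zero_eq_one, ← add_mul] at p1
  have h0 : ‖fourier f 0‖ = 0 := by
    have : fourier f 0 = ((∑ z, f z : ℝ) : ℂ) := by simp [fourier]
    rw [this, hf]; simp
  have hs := sum_mul_le (fun k => ‖fourier f k‖) h0
  have p3 : (m : ℝ) ^ 2 * ∑ z, f z ^ 2 = ∑ k, ‖fourier f k‖ ^ 2 := by
    have : ((∑ k, ‖fourier f k‖ ^ 2 : ℝ) : ℂ) = ((m ^ 2 * ∑ x, f x * f x : ℝ) : ℂ) := by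
      rw [← p2]; push_cast
      exact sum_congr rfl fun k _ => by rw [Complex.mul_conj, Complex.normSq_eq_norm_sq]; simp
    rw [Complex.ofReal_inj.1 this]
    simp only [sq]
  refine le_of_mul_le_mul_left ?_ hm
  rw [mul_left_comm, p3]
  refine le_trans ?_ hs
  refine le_trans (Complex.re_le_norm (((m : ℝ) ^ 2 * _ : ℝ) : ℂ)) ?_
  rw [← p1]
  refine (norm_sum_le _ _).trans (sum_le_sum fun k _ => ?_)
  rw [norm_mul, RCLike.norm_conj]
  have n1 : ‖(1 + ZMod.stdAddChar (-k.1)) * fourier f (k.1, k.2 - 2 * k.1) +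
      (1 + ZMod.stdAddChar (-k.2)) * fourier f (k.1 - 2 * k.2, k.2)‖ ≤
      2 * halfNorm k.1 * ‖fourier f (k.1, k.2 - 2 * k.1)‖ +
      2 * halfNorm k.2 * ‖fourier f (k.1 - 2 * k.2, k.2)‖ := by
    refine (norm_add_le _ _).trans ?_
    rw [norm_mul, norm_mul]
    unfold halfNorm
    apply le_of_eq; ring
  refine (mul_le_mul_of_nonneg_left n1 (norm_nonneg _)).trans (le_of_eq ?_)
  ring

/-- The spectral gap of the Gabber–Galil graph on the torus. -/
theorem gap (f : ZMod m × ZMod m → ℝ) (hf : ∑ z, f z = 0) :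
    7 / 10 * ∑ z, f z ^ 2 ≤
      ∑ t : Fin 2 × Fin 2, ∑ z, (f z - f (shear m (t.1, (t.2 : ℕ)) z)) ^ 2 := by
  -- Expanding the four squares gives 8 ∑ f² minus twice the correlation, and 8 - 2 · 73/20 = 7/10.
  have h := sum_mul_shear_le f hf
  have e : ∀ t : Fin 2 × ZMod m, ∑ z, (f z - f (shear m t z)) ^ 2 =
      2 * ∑ z, f z ^ 2 - 2 * ∑ z, f z * f (shear m t z) := by
    intro t
    have : ∑ z, f (shear m t z) ^ 2 = ∑ z, f z ^ 2 :=
      Equiv.sum_comp (shear m t) (fun z => f z ^ 2)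
    rw [two_mul]
    nth_rewrite 2 [← this]
    rw [mul_sum, ← sum_add_distrib, ← sum_sub_distrib]
    exact sum_congr rfl fun z _ => by ring
  rw [Fintype.sum_prod_type (f := fun t : Fin 2 × Fin 2 =>
    ∑ z, (f z - f (shear m (t.1, (t.2 : ℕ)) z)) ^ 2)]
  simp only [e, Fin.sum_univ_two]
  simp only [mul_add, sum_add_distrib] at h
  norm_num at h ⊢
  linarith

end Margulis

/-! ### Degrees, genus, and the variational bound for λ₁ -/

namespace ConfigGraph

open ConfigModel

variable {χ n : ℕ} (G : ConfigGraph χ n)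

lemma degree_inl (i : Fin χ) : G.degree (Sum.inl i) = 3 := by
  unfold degree
  have : (univ.filter fun h : HalfEdge χ n => origin h = Sum.inl i) =
      univ.image fun a : Fin 3 => (Sum.inl (i, a) : HalfEdge χ n) := by
    ext h
    rw [mem_filter]
    rcases h with ⟨j, a⟩ | j
    · simp [origin, eq_comm]
    · simp [origin]
  rw [this, card_image_of_injective _ fun a b h => by simpa using h]
  simp

lemma degree_inr (j : Fin n) : G.degree (Sum.inr j) = 1 := by
  unfold degree
  have : (univ.filter fun h : HalfEdge χ n => origin h = Sum.inr j) = {Sum.inr j} := by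
    ext h'
    rw [mem_filter]
    rcases h' with ⟨j, a⟩ | j
    · simp [origin]
    · simp [origin]
  rw [this, card_singleton]

lemma degree_pos (v : Vertex χ n) : 0 < G.degree v := by
  rcases v with i | j
  · simp [degree_inl]
  · simp [degree_inr]

lemma card_degree_eq_three : (univ.filter fun v => G.degree v = 3).card = χ := by
  have : (univ.filter fun v => G.degree v = 3) =
      univ.image (Sum.inl : Fin χ → Vertex χ n) := by
    ext v
    rcases v with i | j
    · simp [degree_inl]
    · simp [degree_inr]
  rw [this, card_image_of_injective _ Sum.inl_injective]
  simp

lemma card_degree_eq_one : (univ.filter fun v => G.degree v = 1).card = n := by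
  have : (univ.filter fun v => G.degree v = 1) =
      univ.image (Sum.inr : Fin n → Vertex χ n) := by
    ext v
    rcases v with i | j
    · simp [degree_inl]
    · simp [degree_inr]
  rw [this, card_image_of_injective _ Sum.inr_injective]
  simp

lemma two_mul_card_edges : 2 * G.edges.card = 3 * χ + n := by
  have h := card_eq_sum_card_fiberwise (f := fun h => s(h, G.mate h)) (t := G.edges)
    (s := univ) fun h _ => mem_image_of_mem _ (mem_univ h)
  have hf : ∀ e ∈ G.edges,
      (univ.filter fun h => s(h, G.mate h) = e).card = 2 := by
    intro e he
    obtain ⟨h, -, rfl⟩ := mem_image.1 he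
    have : (univ.filter fun h' => s(h', G.mate h') = s(h, G.mate h)) = {h, G.mate h} := by
      ext h'
      simp only [mem_filter, mem_univ, true_and, mem_insert, mem_singleton, Sym2.eq_iff]
      constructor
      · rintro (h1 | h1)
        · exact Or.inl h1.1
        · exact Or.inr h1.1
      · rintro (rfl | rfl)
        · simp
        · simp [G.mate_mate]
    rw [this, card_pair (G.mate_ne h).symm]
  rw [sum_congr rfl hf, sum_const, smul_eq_mul, card_univ] at h
  simp only [HalfEdge, Fintype.card_sum, Fintype.card_prod, Fintype.card_fin] at h
  omega

lemma genus_eq {g : ℕ} (hg : 1 ≤ g) (G : ConfigGraph (2 * g - 2 + n) n) : G.genus = g := by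
  have h := G.two_mul_card_edges
  unfold genus eulerChar
  simp only [Vertex, Fintype.card_sum, Fintype.card_fin]
  omega

/-- Twice the Dirichlet energy of a function, as a sum over half-edges. -/
def energy (f : Vertex χ n → ℝ) : ℝ :=
  ∑ h : HalfEdge χ n, (f (origin h) - f (origin (G.mate h))) ^ 2

/-- The involution of a good partition as a permutation. -/
def matePerm : Equiv.Perm (HalfEdge χ n) := ⟨G.mate, G.mate, G.mate_mate, G.mate_mate⟩

lemma degree_mul_laplacian (f : Vertex χ n → ℝ) (v : Vertex χ n) :
    (G.degree v : ℝ) * (-G.laplacian) f v =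
      ∑ h : HalfEdge χ n with origin h = v, (f (origin h) - f (origin (G.mate h))) := by
  have hd : (G.degree v : ℝ) ≠ 0 := by exact_mod_cast (G.degree_pos v).ne'
  simp only [LinearMap.neg_apply, Pi.neg_apply, laplacian, LinearMap.coe_mk, AddHom.coe_mk]
  rw [mul_neg, ← mul_assoc, mul_one_div_cancel hd, one_mul, ← sum_neg_distrib]
  refine sum_congr rfl fun h hh => ?_
  rw [(mem_filter.1 hh).2]; ring

lemma sum_mul_laplacian (f f' : Vertex χ n → ℝ) :
    ∑ v, f v * ((G.degree v : ℝ) * (-G.laplacian) f' v) =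
      1 / 2 * ∑ h : HalfEdge χ n, (f (origin h) - f (origin (G.mate h))) *
        (f' (origin h) - f' (origin (G.mate h))) := by
  have h1 : ∑ v, f v * ((G.degree v : ℝ) * (-G.laplacian) f' v) =
      ∑ h : HalfEdge χ n, f (origin h) * (f' (origin h) - f' (origin (G.mate h))) := by
    rw [← sum_fiberwise_of_maps_to (g := origin) (t := univ) (fun _ _ => mem_univ _)]
    refine sum_congr rfl fun v _ => ?_
    rw [degree_mul_laplacian, mul_sum]
    exact sum_congr rfl fun h hh => by rw [(mem_filter.1 hh).2]
  have h2 : ∑ h : HalfEdge χ n, f (origin h) * (f' (origin h) - f' (origin (G.mate h))) =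
      ∑ h : HalfEdge χ n, f (origin (G.mate h)) *
        (f' (origin (G.mate h)) - f' (origin h)) := by
    refine Fintype.sum_equiv G.matePerm _ _ fun h => ?_
    simp [matePerm, G.mate_mate]
  rw [h1]
  have h3 : ∑ h : HalfEdge χ n, (f (origin h) - f (origin (G.mate h))) *
        (f' (origin h) - f' (origin (G.mate h))) =
      ∑ h : HalfEdge χ n, f (origin h) * (f' (origin h) - f' (origin (G.mate h))) +
      ∑ h : HalfEdge χ n, f (origin (G.mate h)) *
        (f' (origin (G.mate h)) - f' (origin h)) := by
    rw [← sum_add_distrib]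
    exact sum_congr rfl fun h _ => by ring
  rw [h3, ← h2]; ring

/-- The matrix of `-Δ`, conjugated by the square roots of the degrees. -/
noncomputable def symMatrix : Matrix (Vertex χ n) (Vertex χ n) ℝ :=
  Matrix.diagonal (fun v => √(G.degree v : ℝ)) * LinearMap.toMatrix' (-G.laplacian) *
    Matrix.diagonal (fun v => (√(G.degree v : ℝ))⁻¹)

lemma sqrt_degree_pos (v : Vertex χ n) : 0 < √(G.degree v : ℝ) :=
  Real.sqrt_pos.2 (by exact_mod_cast G.degree_pos v)

lemma charpoly_symMatrix : G.symMatrix.charpoly = LinearMap.charpoly (-G.laplacian) := by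
  have h : Matrix.diagonal (fun v => (√(G.degree v : ℝ))⁻¹) *
      Matrix.diagonal (fun v => √(G.degree v : ℝ)) = 1 := by
    rw [Matrix.diagonal_mul_diagonal, ← Matrix.diagonal_one]
    congr 1; funext v; exact inv_mul_cancel₀ (G.sqrt_degree_pos v).ne'
  rw [← LinearMap.charpoly_toMatrix (-G.laplacian) (Pi.basisFun ℝ _),
    LinearMap.toMatrix_eq_toMatrix', symMatrix, Matrix.charpoly_mul_comm, ← mul_assoc, h, one_mul]

open Matrix in
-- The substitution x = √deg · f turns the matrix form into the Dirichlet form. Symmetry of the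
-- matrix and the Rayleigh quotients of `-Δ` are both read off from this.
lemma dotProduct_symMatrix (f f' : Vertex χ n → ℝ) :
    (fun v => √(G.degree v : ℝ) * f v) ⬝ᵥ
      (G.symMatrix *ᵥ fun v => √(G.degree v : ℝ) * f' v) =
      1 / 2 * ∑ h : HalfEdge χ n, (f (origin h) - f (origin (G.mate h))) *
        (f' (origin h) - f' (origin (G.mate h))) := by
  have h1 : (Matrix.diagonal (fun v => (√(G.degree v : ℝ))⁻¹) *ᵥ
      fun v => √(G.degree v : ℝ) * f' v) = f' := by
    funext v
    rw [Matrix.mulVec_diagonal, inv_mul_cancel_left₀ (G.sqrt_degree_pos v).ne']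
  unfold symMatrix
  rw [← Matrix.mulVec_mulVec, h1, ← Matrix.mulVec_mulVec, LinearMap.toMatrix'_mulVec,
    ← G.sum_mul_laplacian]
  unfold dotProduct
  refine sum_congr rfl fun v _ => ?_
  rw [Matrix.mulVec_diagonal]
  have : √(G.degree v : ℝ) * √(G.degree v : ℝ) = G.degree v :=
    Real.mul_self_sqrt (Nat.cast_nonneg _)
  linear_combination (f v * (-G.laplacian) f' v) * this

open Matrix in
lemma symMatrix_isHermitian : G.symMatrix.IsHermitian := by
  have key : ∀ x y : Vertex χ n → ℝ, x ⬝ᵥ (G.symMatrix *ᵥ y) = y ⬝ᵥ (G.symMatrix *ᵥ x) := by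
    intro x y
    have e : ∀ x : Vertex χ n → ℝ,
        x = fun v => √(G.degree v : ℝ) * ((√(G.degree v : ℝ))⁻¹ * x v) := by
      intro x; funext v; rw [mul_inv_cancel_left₀ (G.sqrt_degree_pos v).ne']
    rw [e x, e y, dotProduct_symMatrix, dotProduct_symMatrix]
    congr 1
    exact sum_congr rfl fun h _ => mul_comm _ _
  ext i j
  have := key (Pi.single j 1) (Pi.single i 1)
  simpa using this

open Matrix in
/-- A Poincaré inequality for functions of mean zero bounds the first eigenvalue from below. -/
theorem le_lambda1 (hcard : 2 ≤ χ + n) (c : ℝ)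
    (hc : ∀ f : Vertex χ n → ℝ, ∑ v, (G.degree v : ℝ) * f v = 0 →
      c * ∑ v, (G.degree v : ℝ) * f v ^ 2 ≤ 1 / 2 * G.energy f) :
    c ≤ G.lambda1 := by
  have hS := G.symMatrix_isHermitian
  -- at most one eigenvalue is smaller than `c`
  have huniq : ∀ i j, hS.eigenvalues i < c → hS.eigenvalues j < c → i = j := by
    intro i j hi hj
    by_contra hij
    set u : Vertex χ n → Vertex χ n → ℝ := fun i => hS.eigenvectorBasis i with hu
    have horth : ∀ i j, u i ⬝ᵥ u j = if i = j then 1 else 0 := by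
      intro i j
      have := hS.eigenvectorBasis.inner_eq_ite i j
      rw [← this, EuclideanSpace.inner_eq_star_dotProduct]
      simp [hu, dotProduct_comm]
    have hev : ∀ i, G.symMatrix *ᵥ u i = hS.eigenvalues i • u i :=
      fun i => hS.mulVec_eigenvectorBasis i
    set w : Vertex χ n → ℝ := fun v => √(G.degree v : ℝ)
    -- Two eigenvectors span a plane, which meets the hyperplane orthogonal to √deg; a nonzero
    -- vector there corresponds to a function of weighted mean zero violating `hc`.
    obtain ⟨a, b, hab, hw⟩ : ∃ a b : ℝ, (a ≠ 0 ∨ b ≠ 0) ∧ a * (w ⬝ᵥ u i) + b * (w ⬝ᵥ u j) = 0 := by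
      by_cases h : w ⬝ᵥ u j = 0
      · exact ⟨0, 1, by simp, by simp [h]⟩
      · exact ⟨w ⬝ᵥ u j, -(w ⬝ᵥ u i), Or.inl h, by ring⟩
    set y : Vertex χ n → ℝ := a • u i + b • u j with hy
    set f : Vertex χ n → ℝ := fun v => (w v)⁻¹ * y v with hf
    have hfy : y = fun v => w v * f v := by
      funext v; rw [hf]; exact (mul_inv_cancel_left₀ (G.sqrt_degree_pos v).ne' _).symm
    have hww : ∀ v, (G.degree v : ℝ) = w v * w v :=
      fun v => (Real.mul_self_sqrt (Nat.cast_nonneg _)).symm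
    have h0 : ∑ v, (G.degree v : ℝ) * f v = 0 := by
      have : ∑ v, (G.degree v : ℝ) * f v = w ⬝ᵥ y := by
        rw [hfy]; exact sum_congr rfl fun v _ => by rw [hww]; ring
      rw [this, hy, dotProduct_add, dotProduct_smul, dotProduct_smul]
      exact hw
    have h1 : ∑ v, (G.degree v : ℝ) * f v ^ 2 = a ^ 2 + b ^ 2 := by
      have : ∑ v, (G.degree v : ℝ) * f v ^ 2 = y ⬝ᵥ y := by
        rw [hfy]; exact sum_congr rfl fun v _ => by rw [hww]; ring
      rw [this, hy]
      simp only [dotProduct_add, add_dotProduct, dotProduct_smul, smul_dotProduct, horth,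
        if_neg hij, if_neg (Ne.symm hij), smul_eq_mul]
      simp; ring
    have h2 : 1 / 2 * G.energy f = a ^ 2 * hS.eigenvalues i + b ^ 2 * hS.eigenvalues j := by
      have : 1 / 2 * G.energy f = y ⬝ᵥ (G.symMatrix *ᵥ y) := by
        rw [hfy, dotProduct_symMatrix]
        unfold energy
        congr 1
        exact sum_congr rfl fun h _ => sq _
      rw [this, hy]
      simp only [mulVec_add, mulVec_smul, hev, dotProduct_add, add_dotProduct, dotProduct_smul,
        smul_dotProduct, horth, if_neg hij, if_neg (Ne.symm hij), smul_eq_mul]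
      simp; ring
    have h3 := hc f h0
    rw [h1, h2] at h3
    rcases hab with h | h
    · have := pow_pos (abs_pos.2 h) 2
      rw [sq_abs] at this
      nlinarith [sq_nonneg b]
    · have := pow_pos (abs_pos.2 h) 2
      rw [sq_abs] at this
      nlinarith [sq_nonneg a]
  have hroots : (LinearMap.charpoly (-G.laplacian)).roots =
      Multiset.map hS.eigenvalues univ.val := by
    rw [← G.charpoly_symMatrix, hS.roots_charpoly_eq_eigenvalues]
    rfl
  have hcount : (G.eigenvalueList.filter (· < c)).length ≤ 1 := by
    have h1 : ((G.eigenvalueList.filter (· < c)).length : ℕ) =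
        (Multiset.filter (· < c) (Multiset.map hS.eigenvalues univ.val)).card := by
      rw [← hroots, ← Multiset.sort_eq (LinearMap.charpoly (-G.laplacian)).roots (· ≤ ·),
        Multiset.filter_coe, Multiset.coe_card]
      rfl
    rw [h1, Multiset.filter_map, Multiset.card_map]
    change (univ.filter fun i => hS.eigenvalues i < c).card ≤ 1
    rw [card_le_one]
    intro i hi j hj
    exact huniq i j (mem_filter.1 hi).2 (mem_filter.1 hj).2
  have hlen : 2 ≤ G.eigenvalueList.length := by
    unfold eigenvalueList
    rw [Multiset.length_sort, hroots, Multiset.card_map]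
    simpa [Vertex] using hcard
  have hsort : G.eigenvalueList.Pairwise (· ≤ ·) := Multiset.pairwise_sort _ _
  unfold lambda1
  generalize G.eigenvalueList = l at *
  -- If the entry with index 1 were below c, so would be the entry before it, giving two such
  -- entries.
  match l, hlen, hsort, hcount with
  | x :: y :: l, _, hsort, hcount =>
    by_contra! h
    simp only [List.getD_cons_succ, List.getD_cons_zero] at h
    have hxy : x ≤ y := (List.pairwise_cons.1 hsort).1 y (by simp)
    simp [h, hxy.trans_lt h] at hcount

end ConfigGraph

/-! ### Graphs built on a Hamiltonian cycle -/

lemma finRotate_mk {χ k : ℕ} (h : k + 1 < χ) :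
    finRotate χ ⟨k, by omega⟩ = ⟨k + 1, h⟩ := by
  obtain ⟨χ, rfl⟩ : ∃ l, χ = l + 1 := ⟨χ - 1, by omega⟩
  exact finRotate_of_lt (by omega)

lemma val_finRotate {χ : ℕ} (i : Fin χ) : (finRotate χ i : ℕ) = (i + 1) % χ := by
  rcases i with ⟨i, hi⟩
  rcases Nat.lt_or_ge (i + 1) χ with h | h
  · rw [finRotate_mk h, Nat.mod_eq_of_lt h]
  · obtain rfl : χ = i + 1 := by omega
    rw [finRotate_last']; simp

namespace ConfigGraph

open ConfigModel

variable {χ n r : ℕ} {P : Type*}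

/-- The graph whose interior vertices lie on a cycle, where the third half-edges of the interior
vertices are labelled by `P ⊕ (Fin n ⊕ Fin r × Bool)`: those with label in `P` are matched by the
involution `τ`, those with label in `Fin n` are matched with the boundary vertices, and the others
are matched in `r` pairs. -/
def ofCycle (e : P ⊕ (Fin n ⊕ Fin r × Bool) ≃ Fin χ) (τ : P → P) (hτ : ∀ p, τ (τ p) = p)
    (hne : ∀ p, τ p ≠ p) : ConfigGraph χ n where
  mate
    | Sum.inl (i, 0) => Sum.inl (finRotate χ i, 1)
    | Sum.inl (i, 1) => Sum.inl ((finRotate χ).symm i, 0)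
    | Sum.inl (i, 2) =>
      match e.symm i with
      | Sum.inl p => Sum.inl (e (Sum.inl (τ p)), 2)
      | Sum.inr (Sum.inl j) => Sum.inr j
      | Sum.inr (Sum.inr (k, b)) => Sum.inl (e (Sum.inr (Sum.inr (k, !b))), 2)
    | Sum.inr j => Sum.inl (e (Sum.inr (Sum.inl j)), 2)
  mate_mate := by
    rintro (⟨i, a⟩ | j)
    · fin_cases a
      · exact congrArg (fun i => Sum.inl (i, 0)) ((finRotate χ).symm_apply_apply i)
      · exact congrArg (fun i => Sum.inl (i, 1)) ((finRotate χ).apply_symm_apply i)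
      · obtain ⟨x, rfl⟩ := e.surjective i
        rcases x with p | j | ⟨k, b⟩ <;> simp [hτ]
    · simp
  mate_ne := by
    rintro (⟨i, a⟩ | j)
    · fin_cases a
      · simp
      · simp
      · obtain ⟨x, rfl⟩ := e.surjective i
        rcases x with p | j | ⟨k, b⟩ <;> simp [hne]
    · simp
  good := by
    rintro (⟨i, a⟩ | j)
    · simp
    · simp

lemma reachable_origin_mate (G : ConfigGraph χ n) (h : HalfEdge χ n) :
    G.toSimpleGraph.Reachable (origin h) (origin (G.mate h)) := by
  by_cases hh : origin h = origin (G.mate h)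
  · rw [hh]
  · exact SimpleGraph.Adj.reachable
      ((SimpleGraph.fromRel_adj _ _ _).2 ⟨hh, Or.inl ⟨h, rfl, rfl⟩⟩)

section

variable (e : P ⊕ (Fin n ⊕ Fin r × Bool) ≃ Fin χ) (τ : P → P) (hτ : ∀ p, τ (τ p) = p)
  (hne : ∀ p, τ p ≠ p)

lemma ofCycle_connected (hχ : 0 < χ) : (ofCycle e τ hτ hne).Connected := by
  have h1 : ∀ k (hk : k < χ), (ofCycle e τ hτ hne).toSimpleGraph.Reachable
      (Sum.inl ⟨0, hχ⟩) (Sum.inl ⟨k, hk⟩) := by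
    intro k
    induction k with
    | zero => intro _; rfl
    | succ k ih =>
      intro hk
      have h := (ofCycle e τ hτ hne).reachable_origin_mate (Sum.inl (⟨k, by omega⟩, 0))
      simp only [ofCycle, origin, finRotate_mk hk] at h
      exact (ih (by omega)).trans h
  have h2 : ∀ v, (ofCycle e τ hτ hne).toSimpleGraph.Reachable (Sum.inl ⟨0, hχ⟩) v := by
    rintro (i | j)
    · exact h1 i i.2
    · have h := (ofCycle e τ hτ hne).reachable_origin_mate (Sum.inr j)
      exact (h1 _ _).trans h.symm
  exact (SimpleGraph.connected_iff_exists_forall_reachable _).2 ⟨_, h2⟩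

/-- Cycle edges and boundary edges are seen from both ends, hence the factors 2; the sum over P
already runs over both ends. Only the r auxiliary pairs are discarded. -/
lemma le_energy_ofCycle [Fintype P] (f : Vertex χ n → ℝ) :
    2 * ∑ i, (f (Sum.inl i) - f (Sum.inl (finRotate χ i))) ^ 2 +
      ∑ p, (f (Sum.inl (e (Sum.inl p))) - f (Sum.inl (e (Sum.inl (τ p))))) ^ 2 +
      2 * ∑ j, (f (Sum.inr j) - f (Sum.inl (e (Sum.inr (Sum.inl j))))) ^ 2 ≤
      (ofCycle e τ hτ hne).energy f := by
  unfold energy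
  rw [Fintype.sum_sum_type, Fintype.sum_prod_type]
  simp only [Fin.sum_univ_three, sum_add_distrib]
  have h1 : ∑ i, (f (origin (Sum.inl (i, 1) : HalfEdge χ n)) -
      f (origin ((ofCycle e τ hτ hne).mate (Sum.inl (i, 1))))) ^ 2 =
      ∑ i, (f (Sum.inl i) - f (Sum.inl (finRotate χ i))) ^ 2 := by
    refine Fintype.sum_equiv (finRotate χ).symm _ _ fun i => ?_
    simp only [ofCycle, origin, Equiv.apply_symm_apply]
    ring
  have h2 : ∑ i, (f (origin (Sum.inl (i, 2) : HalfEdge χ n)) -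
      f (origin ((ofCycle e τ hτ hne).mate (Sum.inl (i, 2))))) ^ 2 ≥
      ∑ p, (f (Sum.inl (e (Sum.inl p))) - f (Sum.inl (e (Sum.inl (τ p))))) ^ 2 +
      ∑ j, (f (Sum.inr j) - f (Sum.inl (e (Sum.inr (Sum.inl j))))) ^ 2 := by
    rw [← Equiv.sum_comp e, Fintype.sum_sum_type, Fintype.sum_sum_type, ← add_assoc]
    refine le_add_of_le_of_nonneg (le_of_eq ?_) (sum_nonneg fun _ _ => sq_nonneg _)
    simp only [ofCycle, origin, Equiv.symm_apply_apply]
    congr 1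
    exact sum_congr rfl fun _ _ => by ring
  have h3 : ∑ j, (f (origin (Sum.inr j : HalfEdge χ n)) -
      f (origin ((ofCycle e τ hτ hne).mate (Sum.inr j)))) ^ 2 =
      ∑ j, (f (Sum.inr j) - f (Sum.inl (e (Sum.inr (Sum.inl j))))) ^ 2 := rfl
  have h4 : ∑ i, (f (origin (Sum.inl (i, 0) : HalfEdge χ n)) -
      f (origin ((ofCycle e τ hτ hne).mate (Sum.inl (i, 0))))) ^ 2 =
      ∑ i, (f (Sum.inl i) - f (Sum.inl (finRotate χ i))) ^ 2 := rfl
  rw [h1, h3, h4]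
  linarith

end

/-- A partial labelling of the interior vertices extends to a labelling of all of them. -/
lemma exists_labelling [Fintype P] (port : P → Fin χ) (hport : Function.Injective port)
    (hcard : Fintype.card P + n + 2 * r = χ) :
    ∃ e : P ⊕ (Fin n ⊕ Fin r × Bool) ≃ Fin χ, ∀ p, e (Sum.inl p) = port p := by
  classical
  have hc : Fintype.card (Fin n ⊕ Fin r × Bool) = Fintype.card ((Set.range port)ᶜ : Set (Fin χ)) := by
    rw [Fintype.card_compl_set, Set.card_range_of_injective hport]
    simp only [Fintype.card_sum, Fintype.card_prod, Fintype.card_fin, Fintype.card_bool]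
    omega
  refine ⟨((Equiv.ofInjective port hport).sumCongr (Fintype.equivOfCardEq hc)).trans
    (Equiv.Set.sumCompl (Set.range port)), fun p => ?_⟩
  simp

end ConfigGraph

/-! ### Cutting the cycle into arcs -/

lemma sq_sub_le_sum_Ico (F : ℕ → ℝ) {i j : ℕ} (hij : i ≤ j) :
    (F j - F i) ^ 2 ≤ (j - i : ℕ) * ∑ k ∈ Ico i j, (F (k + 1) - F k) ^ 2 := by
  rw [← sum_Ico_sub F hij, ← Nat.card_Ico]
  exact sq_sum_le_card_mul_sum_sq

lemma sq_sub_le_dist_mul (F : ℕ → ℝ) {a b i j : ℕ} (hi : a ≤ i) (hi' : i < b) (hj : a ≤ j)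
    (hj' : j < b) :
    (F i - F j) ^ 2 ≤ Nat.dist i j * ∑ k ∈ Ico a b, (F (k + 1) - F k) ^ 2 := by
  have hsub : ∀ i j, a ≤ i → j < b → ∑ k ∈ Ico i j, (F (k + 1) - F k) ^ 2 ≤
      ∑ k ∈ Ico a b, (F (k + 1) - F k) ^ 2 := fun i j hi hj =>
    sum_le_sum_of_subset_of_nonneg (Ico_subset_Ico hi hj.le) fun _ _ _ => sq_nonneg _
  rcases le_total i j with h | h
  · rw [Nat.dist_eq_sub_of_le h, ← neg_sq, neg_sub]
    exact (sq_sub_le_sum_Ico F h).trans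
      (mul_le_mul_of_nonneg_left (hsub i j hi hj') (Nat.cast_nonneg _))
  · rw [Nat.dist_eq_sub_of_le_right h]
    exact (sq_sub_le_sum_Ico F h).trans
      (mul_le_mul_of_nonneg_left (hsub j i hj hi') (Nat.cast_nonneg _))

/-- Every value is compared with the one at the reference point a + 3 through u² ≤ 2v² + 2(u - v)²,
at distance at most K, and at most K values are summed. -/
lemma sum_sq_Ico_le (F : ℕ → ℝ) {a b K : ℕ} (h8 : a + 8 ≤ b) (hK : b ≤ a + K) :
    ∑ i ∈ Ico a b, F i ^ 2 ≤
      2 * K * F (a + 3) ^ 2 + 2 * K ^ 2 * ∑ k ∈ Ico a b, (F (k + 1) - F k) ^ 2 := by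
  set E := ∑ k ∈ Ico a b, (F (k + 1) - F k) ^ 2 with hE
  have hE0 : 0 ≤ E := sum_nonneg fun _ _ => sq_nonneg _
  have h1 : ∀ i ∈ Ico a b, F i ^ 2 ≤ 2 * F (a + 3) ^ 2 + 2 * (K * E) := by
    intro i hi
    rw [mem_Ico] at hi
    have h2 := sq_sub_le_dist_mul F hi.1 hi.2 (show a ≤ a + 3 by omega) (by omega)
    have h3 : (Nat.dist i (a + 3) : ℝ) * E ≤ K * E := by
      refine mul_le_mul_of_nonneg_right ?_ hE0
      have : Nat.dist i (a + 3) ≤ K := by unfold Nat.dist; omega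
      exact_mod_cast this
    nlinarith [sq_nonneg (F i - 2 * F (a + 3))]
  have hc : ((Ico a b).card : ℝ) ≤ K := by
    rw [Nat.card_Ico]; exact_mod_cast (by omega : b - a ≤ K)
  calc _ ≤ ∑ i ∈ Ico a b, (2 * F (a + 3) ^ 2 + 2 * (K * E)) := sum_le_sum h1
    _ = (Ico a b).card * (2 * F (a + 3) ^ 2 + 2 * (K * E)) := by rw [sum_const, nsmul_eq_mul]
    _ ≤ K * (2 * F (a + 3) ^ 2 + 2 * (K * E)) :=
        mul_le_mul_of_nonneg_right hc (by positivity)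
    _ = _ := by ring

/-- The constant is the sum of the distances of 0, …, 7 to 3: 3 + 2 + 1 + 0 + 1 + 2 + 3 + 4 = 16. -/
lemma sum_sq_sub_le (F : ℕ → ℝ) {a b : ℕ} (h8 : a + 8 ≤ b) :
    ∑ j : Fin 8, (F (a + j) - F (a + 3)) ^ 2 ≤
      16 * ∑ k ∈ Ico a b, (F (k + 1) - F k) ^ 2 := by
  calc _ ≤ ∑ j : Fin 8, (Nat.dist (j : ℕ) 3 : ℝ) * ∑ k ∈ Ico a b, (F (k + 1) - F k) ^ 2 := by
        refine sum_le_sum fun j _ => ?_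
        have := sq_sub_le_dist_mul F (show a ≤ a + j by omega) (show a + j < b by omega)
          (show a ≤ a + 3 by omega) (show a + 3 < b by omega)
        rwa [Nat.dist_add_add_left] at this
    _ = _ := by
        rw [← sum_mul]
        congr 1
        exact_mod_cast (by decide : ∑ j : Fin 8, Nat.dist (j : ℕ) 3 = 16)

lemma sum_range_sum_Ico (s : ℕ → ℕ) (hs : Monotone s) (d : ℕ → ℝ) (N : ℕ) :
    ∑ b ∈ range N, ∑ i ∈ Ico (s b) (s (b + 1)), d i = ∑ i ∈ Ico (s 0) (s N), d i := by
  induction N with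
  | zero => simp
  | succ N ih =>
    rw [sum_range_succ, ih, sum_Ico_consecutive d (hs (Nat.zero_le _)) (hs (Nat.le_succ _))]

/-- The start of the `b`-th of `N` consecutive intervals of almost equal lengths. -/
def blockStart (χ N b : ℕ) : ℕ := b * χ / N

section

variable {χ N K : ℕ}

lemma blockStart_mono : Monotone (blockStart χ N) := fun _ _ h =>
  Nat.div_le_div_right (Nat.mul_le_mul_right _ h)

lemma blockStart_self (hN : 0 < N) : blockStart χ N N = χ :=
  Nat.mul_div_cancel_left _ hN

lemma blockStart_add_le (hN : 0 < N) (h : 8 * N ≤ χ) (b : ℕ) :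
    blockStart χ N b + 8 ≤ blockStart χ N (b + 1) := by
  unfold blockStart
  rw [← Nat.add_mul_div_right _ _ hN]
  exact Nat.div_le_div_right (by rw [add_mul]; omega)

lemma blockStart_succ_le (hN : 0 < N) (h : χ ≤ K * N) (b : ℕ) :
    blockStart χ N (b + 1) ≤ blockStart χ N b + K := by
  unfold blockStart
  rw [← Nat.add_mul_div_right _ _ hN]
  exact Nat.div_le_div_right (by rw [add_mul]; omega)

lemma blockStart_add_lt (hN : 0 < N) (h : 8 * N ≤ χ) (b : Fin N) (j : Fin 8) :
    blockStart χ N b + j < χ := by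
  have h1 := blockStart_add_le hN h b
  have h2 : blockStart χ N (b + 1) ≤ blockStart χ N N := blockStart_mono (by omega)
  rw [blockStart_self hN] at h2
  omega

/-- The first eight elements of the intervals. -/
def blockPort (hN : 0 < N) (h : 8 * N ≤ χ) (b : Fin N) (j : Fin 8) : Fin χ :=
  ⟨blockStart χ N b + j, blockStart_add_lt hN h b j⟩

lemma blockPort_inj (hN : 0 < N) (h : 8 * N ≤ χ) {b b' : Fin N} {j j' : Fin 8}
    (heq : blockPort hN h b j = blockPort hN h b' j') : b = b' ∧ j = j' := by
  have heq' : blockStart χ N b + j = blockStart χ N b' + j' := by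
    simpa [blockPort] using heq
  have key : ∀ c c' : Fin N, c < c' → blockStart χ N c + 8 ≤ blockStart χ N c' :=
    fun c c' hc => (blockStart_add_le hN h c).trans (blockStart_mono (by omega))
  rcases lt_trichotomy b b' with hb | rfl | hb
  · have := key _ _ hb; omega
  · exact ⟨rfl, by omega⟩
  · have := key _ _ hb; omega

/-- The energy of a function along the cycle. -/
def cycleEnergy (f : Fin χ → ℝ) : ℝ := ∑ i, (f i - f (finRotate χ i)) ^ 2

/-- The periodic extension of a function on the cycle. -/
def periodic (hχ : 0 < χ) (f : Fin χ → ℝ) (i : ℕ) : ℝ := f ⟨i % χ, Nat.mod_lt _ hχ⟩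

lemma periodic_of_lt (hχ : 0 < χ) (f : Fin χ → ℝ) {i : ℕ} (hi : i < χ) :
    periodic hχ f i = f ⟨i, hi⟩ := by
  unfold periodic; congr 2; exact Nat.mod_eq_of_lt hi

/-- The increment at the last index of an arc leads into the next arc, and periodicity closes the
cycle from χ - 1 to 0, so each cycle edge is counted exactly once. -/
lemma sum_block_energy (hN : 0 < N) (hχ : 0 < χ) (f : Fin χ → ℝ) :
    ∑ b : Fin N, ∑ k ∈ Ico (blockStart χ N b) (blockStart χ N (b + 1)),
      (periodic hχ f (k + 1) - periodic hχ f k) ^ 2 = cycleEnergy f := by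
  rw [Fin.sum_univ_eq_sum_range (fun b => ∑ k ∈ Ico (blockStart χ N b) (blockStart χ N (b + 1)),
      (periodic hχ f (k + 1) - periodic hχ f k) ^ 2) N,
    sum_range_sum_Ico _ blockStart_mono (fun k => (periodic hχ f (k + 1) - periodic hχ f k) ^ 2) N,
    blockStart_self hN]
  have : blockStart χ N 0 = 0 := by simp [blockStart]
  rw [this, ← range_eq_Ico, ← Fin.sum_univ_eq_sum_range]
  refine sum_congr rfl fun i _ => ?_
  have h1 : periodic hχ f (i + 1) = f (finRotate χ i) := by
    exact congrArg f (Fin.ext (val_finRotate i).symm)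
  rw [h1, periodic_of_lt hχ f i.2]
  ring

lemma sum_sq_le_blockPort (hN : 0 < N) (h : 8 * N ≤ χ) (hK : χ ≤ K * N) (f : Fin χ → ℝ) :
    ∑ i, f i ^ 2 ≤ 2 * K * ∑ b, f (blockPort hN h b 3) ^ 2 + 2 * K ^ 2 * cycleEnergy f := by
  have hχ : 0 < χ := by omega
  rw [← sum_block_energy hN hχ f, mul_sum, mul_sum, ← sum_add_distrib]
  have h1 : ∑ i, f i ^ 2 = ∑ b : Fin N,
      ∑ k ∈ Ico (blockStart χ N b) (blockStart χ N (b + 1)), periodic hχ f k ^ 2 := by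
    rw [Fin.sum_univ_eq_sum_range (fun b =>
        ∑ k ∈ Ico (blockStart χ N b) (blockStart χ N (b + 1)), periodic hχ f k ^ 2) N,
      sum_range_sum_Ico _ blockStart_mono (fun k => periodic hχ f k ^ 2) N, blockStart_self hN]
    have : blockStart χ N 0 = 0 := by simp [blockStart]
    rw [this, ← range_eq_Ico, ← Fin.sum_univ_eq_sum_range]
    exact sum_congr rfl fun i _ => by rw [periodic_of_lt hχ f i.2]
  rw [h1]
  refine sum_le_sum fun b _ => ?_
  have h2 := sum_sq_Ico_le (periodic hχ f) (blockStart_add_le hN h b) (blockStart_succ_le hN hK b)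
  have h3 : periodic hχ f (blockStart χ N b + 3) = f (blockPort hN h b 3) :=
    periodic_of_lt hχ f (blockStart_add_lt hN h b 3)
  rwa [h3] at h2

lemma sum_port_sub_le (hN : 0 < N) (h : 8 * N ≤ χ) (f : Fin χ → ℝ) :
    ∑ b, ∑ j, (f (blockPort hN h b j) - f (blockPort hN h b 3)) ^ 2 ≤ 16 * cycleEnergy f := by
  have hχ : 0 < χ := by omega
  rw [← sum_block_energy hN hχ f, mul_sum]
  refine sum_le_sum fun b _ => ?_
  have h2 := sum_sq_sub_le (periodic hχ f) (blockStart_add_le hN h b)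
  have h3 : periodic hχ f (blockStart χ N b + 3) = f (blockPort hN h b 3) :=
    periodic_of_lt hχ f (blockStart_add_lt hN h b 3)
  rw [h3] at h2
  refine le_trans (le_of_eq (sum_congr rfl fun j _ => ?_)) h2
  rw [periodic_of_lt hχ f (blockStart_add_lt hN h b j)]
  rfl

end

/-! ### Transfer of the gap from the torus to the cubic graph -/

namespace Margulis

/-- The half-edges of the Gabber–Galil graph: the endpoints of the edge from `z` to
`shear m (t.1, t.2) z` are `(z, t, true)` and `(shear m (t.1, t.2) z, t, false)`. -/
abbrev Port (m : ℕ) : Type := (ZMod m × ZMod m) × ((Fin 2 × Fin 2) × Bool)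

/-- The matching of the half-edges of the Gabber–Galil graph. -/
def portMate (m : ℕ) : Port m → Port m
  | (z, (t, true)) => (shear m (t.1, (t.2 : ℕ)) z, (t, false))
  | (z, (t, false)) => ((shear m (t.1, (t.2 : ℕ))).symm z, (t, true))

lemma portMate_portMate {m : ℕ} (p : Port m) : portMate m (portMate m p) = p := by
  rcases p with ⟨z, t, _ | _⟩ <;> simp [portMate]

lemma portMate_ne {m : ℕ} (p : Port m) : portMate m p ≠ p := by
  rcases p with ⟨z, t, _ | _⟩ <;> simp [portMate]

variable {m : ℕ} [NeZero m]

lemma sum_port_sub (y : Port m → ℝ) :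
    ∑ p, (y p - y (portMate m p)) ^ 2 = 2 * ∑ t : Fin 2 × Fin 2, ∑ z,
      (y (z, (t, true)) - y (shear m (t.1, (t.2 : ℕ)) z, (t, false))) ^ 2 := by
  rw [Fintype.sum_prod_type_right, Fintype.sum_prod_type, mul_sum]
  refine sum_congr rfl fun t _ => ?_
  rw [Fintype.sum_bool, two_mul]
  congr 1
  refine Fintype.sum_equiv (shear m (t.1, (t.2 : ℕ))).symm _ _ fun z => ?_
  simp only [portMate, Equiv.apply_symm_apply]
  ring

/-- Comparison of the values `x z` at the vertices of the Gabber–Galil graph with values at the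
half-edges. -/
lemma sum_sq_le (x : ZMod m × ZMod m → ℝ) (hx : ∑ z, x z = 0) (y : Port m → ℝ) :
    7 / 10 * ∑ z, x z ^ 2 ≤ 3 / 2 * ∑ p, (y p - y (portMate m p)) ^ 2 +
      3 * ∑ z, ∑ q, (y (z, q) - x z) ^ 2 := by
  have h : ∑ z, ∑ q, (y (z, q) - x z) ^ 2 = ∑ t : Fin 2 × Fin 2,
      ∑ z, ((y (z, (t, true)) - x z) ^ 2 +
        (y (shear m (t.1, (t.2 : ℕ)) z, (t, false)) - x (shear m (t.1, (t.2 : ℕ)) z)) ^ 2) := by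
    rw [sum_comm, Fintype.sum_prod_type]
    refine sum_congr rfl fun t _ => ?_
    rw [Fintype.sum_bool, sum_add_distrib]
    congr 1
    exact (Equiv.sum_comp (shear m (t.1, (t.2 : ℕ))) fun z => (y (z, (t, false)) - x z) ^ 2).symm
  refine (gap x hx).trans ?_
  rw [sum_port_sub, h, ← mul_assoc, mul_sum, mul_sum, ← sum_add_distrib]
  refine sum_le_sum fun t _ => ?_
  rw [mul_sum, mul_sum, ← sum_add_distrib]
  refine sum_le_sum fun z _ => ?_
  generalize x (shear m (t.1, (t.2 : ℕ)) z) = x'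
  generalize y (shear m (t.1, (t.2 : ℕ)) z, (t, false)) = y'
  generalize y (z, (t, true)) = y
  -- This is (p + q + r)² ≤ 3(p² + q² + r²) along the path x, y, y', x'.
  nlinarith [sq_nonneg ((y - x z) + (y - y')), sq_nonneg ((y' - x') + (y' - y)),
    sq_nonneg ((y - x z) - (x' - y'))]

end Margulis

namespace ConfigGraph

open ConfigModel Margulis

variable {χ n r m K : ℕ}

/-- The positions of the half-edges of the Gabber–Galil graph on the cycle. -/
noncomputable def port [NeZero m] (h : 8 * (m * m) ≤ χ) (p : Port m) : Fin χ :=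
  blockPort (Nat.mul_pos (NeZero.pos m) (NeZero.pos m)) h
    (Fintype.equivFinOfCardEq (by simp [ZMod.card]) p.1)
    (Fintype.equivFinOfCardEq (by simp) p.2)

lemma port_injective [NeZero m] (h : 8 * (m * m) ≤ χ) :
    Function.Injective (port (m := m) h) := by
  intro p q hpq
  have := blockPort_inj _ h hpq
  exact Prod.ext ((Equiv.injective _) this.1) ((Equiv.injective _) this.2)

lemma sum_degree_mul (G : ConfigGraph χ n) (f : Vertex χ n → ℝ) :
    ∑ v, (G.degree v : ℝ) * f v = 3 * ∑ i, f (Sum.inl i) + ∑ j, f (Sum.inr j) := by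
  rw [Fintype.sum_sum_type, mul_sum]
  simp [degree_inl, degree_inr]

/-- Poincaré inequality for a graph whose matching contains a Gabber–Galil graph, for functions
whose mean over the centres of the blocks vanishes. -/
lemma poincare_of_centres [NeZero m] (h : 8 * (m * m) ≤ χ) (hK : χ ≤ K * (m * m)) (hK1 : 1 ≤ K)
    (e : Port m ⊕ (Fin n ⊕ Fin r × Bool) ≃ Fin χ) (he : ∀ p, e (Sum.inl p) = port h p)
    (f : Vertex χ n → ℝ)
    (hf : ∑ b, f (Sum.inl (blockPort (Nat.mul_pos (NeZero.pos m) (NeZero.pos m)) h b 3)) = 0) :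
    let G := ofCycle e (portMate m) portMate_portMate portMate_ne
    ∑ v, (G.degree v : ℝ) * f v ^ 2 ≤
      (10 * K ^ 2 + 686 * K + 2 : ℝ) * (1 / 2 * G.energy f) := by
  intro G
  have hN : 0 < m * m := Nat.mul_pos (NeZero.pos m) (NeZero.pos m)
  have hE := le_energy_ofCycle e (portMate m) portMate_portMate portMate_ne f
  set f' : Fin χ → ℝ := fun i => f (Sum.inl i) with hf'
  have hA : ∑ i, (f (Sum.inl i) - f (Sum.inl (finRotate χ i))) ^ 2 = cycleEnergy f' := rfl
  rw [hA] at hE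
  set A := cycleEnergy f'
  set L := ∑ j, (f (Sum.inr j) - f (Sum.inl (e (Sum.inr (Sum.inl j))))) ^ 2 with hL
  set M := ∑ p, (f (Sum.inl (e (Sum.inl p))) - f (Sum.inl (e (Sum.inl (portMate m p))))) ^ 2
    with hM
  have hA0 : 0 ≤ A := sum_nonneg fun _ _ => sq_nonneg _
  have hL0 : 0 ≤ L := sum_nonneg fun _ _ => sq_nonneg _
  have hM0 : 0 ≤ M := sum_nonneg fun _ _ => sq_nonneg _
  have h1 := sum_sq_le_blockPort hN h hK f'
  have h2 := sum_port_sub_le hN h f'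
  set X := ∑ b, f' (blockPort hN h b 3) ^ 2 with hX
  -- The expander inequality at the arc centres; the deviations of the eight port values from their
  -- centre cost 16 A in total.
  have h3 : 7 / 10 * X ≤ 3 / 2 * M + 3 * (16 * A) := by
    let ι : ZMod m × ZMod m ≃ Fin (m * m) := Fintype.equivFinOfCardEq (by simp [ZMod.card])
    let κ : (Fin 2 × Fin 2) × Bool ≃ Fin 8 := Fintype.equivFinOfCardEq (by simp)
    have h4 := Margulis.sum_sq_le (fun z => f' (blockPort hN h (ι z) 3))
      (by rw [← hf]; exact Equiv.sum_comp ι fun b => f' (blockPort hN h b 3))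
      (fun p => f' (port h p))
    have h5 : ∑ z, f' (blockPort hN h (ι z) 3) ^ 2 = X :=
      Equiv.sum_comp ι fun b => f' (blockPort hN h b 3) ^ 2
    have h6 : ∑ z, ∑ q, (f' (port h (z, q)) - f' (blockPort hN h (ι z) 3)) ^ 2 =
        ∑ b, ∑ j, (f' (blockPort hN h b j) - f' (blockPort hN h b 3)) ^ 2 := by
      rw [← Equiv.sum_comp ι]
      refine sum_congr rfl fun z _ => ?_
      rw [← Equiv.sum_comp κ]
      rfl
    have h7 : ∑ p, (f' (port h p) - f' (port h (portMate m p))) ^ 2 = M := by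
      simp only [hM, he, hf']
    rw [h5, h6, h7] at h4
    linarith
  have h8 : ∑ j, f (Sum.inr j) ^ 2 ≤ 2 * ∑ i, f' i ^ 2 + 2 * L := by
    have h9 : ∑ j : Fin n, f' (e (Sum.inr (Sum.inl j))) ^ 2 ≤ ∑ i, f' i ^ 2 := by
      rw [← Equiv.sum_comp e, Fintype.sum_sum_type, Fintype.sum_sum_type]
      have n1 : 0 ≤ ∑ p, f' (e (Sum.inl p)) ^ 2 := sum_nonneg fun _ _ => sq_nonneg _
      have n2 : 0 ≤ ∑ q, f' (e (Sum.inr (Sum.inr q))) ^ 2 := sum_nonneg fun _ _ => sq_nonneg _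
      linarith
    have h10 : ∑ j, f (Sum.inr j) ^ 2 ≤
        2 * ∑ j : Fin n, f' (e (Sum.inr (Sum.inl j))) ^ 2 + 2 * L := by
      rw [hL, mul_sum, mul_sum, ← sum_add_distrib]
      refine sum_le_sum fun j _ => ?_
      simp only [hf']
      nlinarith [sq_nonneg (f (Sum.inr j) - 2 * f (Sum.inl (e (Sum.inr (Sum.inl j)))))]
    linarith
  rw [sum_degree_mul]
  have hE' : A + M / 2 + L ≤ 1 / 2 * G.energy f := by linarith
  have hK1' : (1 : ℝ) ≤ K := by exact_mod_cast hK1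
  refine le_trans ?_ (mul_le_mul_of_nonneg_left hE' (by positivity))
  -- With S the sum of f² over interior vertices, the left side is at most 5S + 2L and S ≤ 2K X +
  -- 2K² A. Inserting X ≤ 480/7 A + 15/7 M yields the coefficient 10K² + 4800/7 K of A, and 4800/7 <
  -- 686.
  have hKX : K * X ≤ K * (480 / 7 * A + 15 / 7 * M) :=
    mul_le_mul_of_nonneg_left (by linarith) (by linarith)
  have hfsum : ∑ i, f (Sum.inl i) ^ 2 = ∑ i, f' i ^ 2 := rfl
  rw [hfsum]
  nlinarith [mul_nonneg (show (0 : ℝ) ≤ K by linarith) hM0,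
    mul_nonneg (show (0 : ℝ) ≤ K by linarith) hL0, mul_nonneg (sq_nonneg (K : ℝ)) hM0,
    mul_nonneg (sq_nonneg (K : ℝ)) hL0, mul_nonneg (show (0 : ℝ) ≤ K by linarith) hA0]

lemma energy_sub_const (G : ConfigGraph χ n) (f : Vertex χ n → ℝ) (c : ℝ) :
    G.energy (fun v => f v - c) = G.energy f := by
  unfold energy
  exact sum_congr rfl fun h _ => by ring

theorem le_lambda1_of_margulis [NeZero m] (h : 8 * (m * m) ≤ χ) (hK : χ ≤ K * (m * m))
    (hK1 : 1 ≤ K) (e : Port m ⊕ (Fin n ⊕ Fin r × Bool) ≃ Fin χ)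
    (he : ∀ p, e (Sum.inl p) = port h p) :
    1 / (10 * K ^ 2 + 686 * K + 2 : ℝ) ≤
      (ofCycle e (portMate m) portMate_portMate portMate_ne).lambda1 := by
  have hN : 0 < m * m := Nat.mul_pos (NeZero.pos m) (NeZero.pos m)
  refine le_lambda1 _ (by omega) _ fun f hf => ?_
  set G := ofCycle e (portMate m) portMate_portMate portMate_ne with hG
  set S := ∑ b, f (Sum.inl (blockPort hN h b 3)) with hS
  set c : ℝ := S / (m * m : ℕ) with hc
  have h1 := poincare_of_centres h hK hK1 e he (fun v => f v - c) (by
    rw [sum_sub_distrib, sum_const, card_univ, Fintype.card_fin, nsmul_eq_mul, hc,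
      mul_div_cancel₀ _ (by exact_mod_cast hN.ne')]
    exact sub_self _)
  simp only at h1
  rw [← hG, energy_sub_const] at h1
  -- The degree-weighted mean of f is 0, so replacing f by f - c to centre it on the arc centres can
  -- only increase the weighted square norm.
  have h2 : ∑ v, (G.degree v : ℝ) * f v ^ 2 ≤ ∑ v, (G.degree v : ℝ) * (f v - c) ^ 2 := by
    have : ∑ v, (G.degree v : ℝ) * (f v - c) ^ 2 = ∑ v, (G.degree v : ℝ) * f v ^ 2 -
        2 * c * ∑ v, (G.degree v : ℝ) * f v + ∑ v, (G.degree v : ℝ) * c ^ 2 := by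
      rw [mul_sum, ← sum_sub_distrib, ← sum_add_distrib]
      exact sum_congr rfl fun v _ => by ring
    rw [this, hf]
    have : 0 ≤ ∑ v, (G.degree v : ℝ) * c ^ 2 := sum_nonneg fun _ _ => by positivity
    linarith
  rw [one_div, inv_mul_le_iff₀ (by positivity)]
  exact h2.trans h1

/-- For all `g, n ≥ 1` there is a connected graph of genus `g` with `n` boundary vertices whose
spectral gap is bounded below in terms of the ratio of its size and `g`. -/
theorem exists_connected_le_lambda1 (g n : ℕ) (hg : 1 ≤ g) (hn : 1 ≤ n) :
    ∃ G : ConfigGraph (2 * g - 2 + n) n, G.Connected ∧ ∀ K : ℕ, 1 ≤ K →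
      ∀ m : ℕ, m = Nat.sqrt ((g - 1) / 4) → 0 < m → 2 * g - 2 + n ≤ K * (m * m) →
      1 / (10 * K ^ 2 + 686 * K + 2 : ℝ) ≤ G.lambda1 := by
  set m := Nat.sqrt ((g - 1) / 4) with hm
  have hmm : m * m ≤ (g - 1) / 4 := Nat.sqrt_le _
  rcases Nat.eq_zero_or_pos m with h0 | hpos
  -- For m = 0 the spectral claim is vacuous, and any graph on the cycle will do.
  · obtain ⟨e, -⟩ := exists_labelling (χ := 2 * g - 2 + n) (n := n) (r := g - 1) (P := Empty)
      (fun p => p.elim) (fun p => p.elim) (by simp; omega)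
    refine ⟨ofCycle e id (fun p => p.elim) (fun p => p.elim), ofCycle_connected _ _ _ _ (by omega),
      ?_⟩
    rintro K - m' rfl hm'
    omega
  · have : NeZero m := ⟨hpos.ne'⟩
    have h : 8 * (m * m) ≤ 2 * g - 2 + n := by omega
    -- The ports use 8m² ≤ 2(g - 1) third half-edges and the boundary uses n, which leaves 2(g - 1 -
    -- 4m²) to be paired.
    obtain ⟨e, he⟩ := exists_labelling (n := n) (r := g - 1 - 4 * (m * m)) (port (m := m) h)
      (port_injective h) (by simp [ZMod.card]; omega)
    refine ⟨ofCycle e (portMate m) portMate_portMate portMate_ne,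
      ofCycle_connected _ _ _ _ (by omega), ?_⟩
    rintro K hK m' rfl - hKm
    exact le_lambda1_of_margulis h hKm hK e he

end ConfigGraph

/-! ### Choice of parameters and the limit -/

/-- The largest square below `(g - 1) / 4` is asymptotic to `g / 4`. -/
lemma eventually_le_mul_sqrt_mul_sqrt {c K : ℝ} (hc : 0 ≤ c) (hK : 4 * c < K) :
    ∀ᶠ g : ℕ in Filter.atTop,
      c * g ≤ K * (Nat.sqrt ((g - 1) / 4) * Nat.sqrt ((g - 1) / 4) : ℕ) := by
  have hd : 0 < K - 4 * c := by linarith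
  obtain ⟨B, hB⟩ := exists_nat_ge (12 * c / (K - 4 * c))
  filter_upwards [Filter.eventually_ge_atTop (4 * ((B + 1) * (B + 1)) + 1)] with g hg
  set m := Nat.sqrt ((g - 1) / 4) with hm
  have hmB : B + 1 ≤ m := Nat.le_sqrt.2 (by omega)
  have hgm : g ≤ 4 * ((m + 1) * (m + 1)) := by
    have : (g - 1) / 4 < (m + 1) * (m + 1) := Nat.lt_succ_sqrt _
    omega
  have hgm' : (g : ℝ) ≤ 4 * ((m + 1) * (m + 1)) := by exact_mod_cast hgm
  have hmB' : (B : ℝ) + 1 ≤ m := by exact_mod_cast hmB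
  have hm1 : (1 : ℝ) ≤ m := by linarith [Nat.cast_nonneg (α := ℝ) B]
  rw [div_le_iff₀ hd] at hB
  -- From g ≤ 4(m + 1)² and 2m + 1 ≤ 3m, it suffices that 12 c m ≤ (K - 4c) m².
  have h1 : 12 * c ≤ m * (K - 4 * c) := by nlinarith
  have h2 : 12 * c * m ≤ m * (K - 4 * c) * m := mul_le_mul_of_nonneg_right h1 (by linarith)
  have h3 : c * g ≤ c * (4 * ((m + 1) * (m + 1))) := mul_le_mul_of_nonneg_left hgm' hc
  have h4 : c * 1 ≤ c * m := mul_le_mul_of_nonneg_left hm1 hc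
  push_cast
  nlinarith

theorem theorem1p3 (θ : ℝ) (hθ : 0 < θ) :
    ∃ (n : ℕ+ → ℕ+)
      (G : ∀ g : ℕ+, ConfigGraph (2 * (g : ℕ) - 2 + (n g : ℕ)) (n g : ℕ)),
      (∀ g : ℕ+, (G g).Connected) ∧
      (∀ g : ℕ+,
        (Finset.univ.filter fun v => (G g).degree v = 3).card = 2 * (g : ℕ) - 2 + (n g : ℕ) ∧
        (Finset.univ.filter fun v => (G g).degree v = 1).card = (n g : ℕ) ∧
        (G g).genus = (g : ℤ)) ∧
      Filter.Tendsto (fun g : ℕ+ => ((n g : ℕ) : ℝ) / ((g : ℕ) : ℝ)) Filter.atTop (nhds θ) ∧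
      ((1 / (648 * (θ + 4) ^ 2) : ℝ) : EReal) ≤
        Filter.liminf (fun g : ℕ+ => ((G g).lambda1 : EReal)) Filter.atTop := by
  have hpos : ∀ g : ℕ+, 0 < ⌈θ * (g : ℕ)⌉₊ := fun g =>
    Nat.ceil_pos.2 (mul_pos hθ (by exact_mod_cast g.pos))
  choose G hconn hgap using fun g : ℕ+ =>
    ConfigGraph.exists_connected_le_lambda1 g ⌈θ * (g : ℕ)⌉₊ g.pos (hpos g)
  refine ⟨fun g => ⟨⌈θ * (g : ℕ)⌉₊, hpos g⟩, G, hconn, fun g => ⟨(G g).card_degree_eq_three,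
    (G g).card_degree_eq_one, (G g).genus_eq g.pos⟩, ?_, ?_⟩
  · have h := (tendsto_nat_ceil_mul_div_atTop hθ.le).comp
      (tendsto_natCast_atTop_atTop.comp tendsto_PNat_val_atTop_atTop)
    exact h
  · refine Filter.le_liminf_of_le (by isBoundedDefault) ?_
    -- An integer strictly above 4(θ + 2), as the comparison of (θ + 2)g with K m² requires, and at
    -- most 4θ + 9.
    set K : ℕ := ⌊4 * θ + 8⌋₊ + 1 with hK
    have hK1 : 4 * θ + 8 < K := by rw [hK]; push_cast; exact Nat.lt_floor_add_one _
    have hK2 : (K : ℝ) ≤ 4 * θ + 9 := by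
      rw [hK]; push_cast
      linarith [Nat.floor_le (show 0 ≤ 4 * θ + 8 by positivity)]
    have hev := tendsto_PNat_val_atTop_atTop.eventually
      (eventually_le_mul_sqrt_mul_sqrt (c := θ + 2) (K := K) (by linarith) (by linarith))
    filter_upwards [hev] with g hg
    rw [EReal.coe_le_coe_iff]
    have hg0 : (0 : ℝ) < (g : ℕ) := by exact_mod_cast g.pos
    refine le_trans ?_ (hgap g K (by omega) _ rfl ?_ ?_)
    -- For K ≤ 4θ + 9 the denominator is at most 160θ² + 3464θ + 6986, while 648(θ + 4)² = 648θ² +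
    -- 5184θ + 10368.
    · apply one_div_le_one_div_of_le (by positivity)
      nlinarith [sq_nonneg (θ - (K - 9) / 4)]
    · by_contra h0
      have h0' : Nat.sqrt (((g : ℕ) - 1) / 4) = 0 := by omega
      rw [h0'] at hg
      have : 0 < (θ + 2) * (g : ℕ) := by positivity
      simp at hg
      linarith
    -- The -2 in the vertex count absorbs the rounding up of θg, so χ ≤ (θ + 2)g.
    · have hceil := Nat.ceil_lt_add_one (show 0 ≤ θ * (g : ℕ) by positivity)
      have hcast : ((2 * (g : ℕ) - 2 + ⌈θ * (g : ℕ)⌉₊ : ℕ) : ℝ) = 2 * (g : ℕ) - 2 + ⌈θ * (g : ℕ)⌉₊ := by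
        have := g.pos
        rw [Nat.cast_add, Nat.cast_sub (by omega)]; push_cast; ring
      have : ((2 * (g : ℕ) - 2 + ⌈θ * (g : ℕ)⌉₊ : ℕ) : ℝ) ≤ (K * (Nat.sqrt (((g : ℕ) - 1) / 4) *
          Nat.sqrt (((g : ℕ) - 1) / 4)) : ℕ) := by
        rw [hcast, Nat.cast_mul]
        linarith
      exact_mod_cast this
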